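/- Let $n>1$ and let $\mathbb M^n$ be $n$-dimensional Minkowski space, $\mathbb R^n$ with the form $\langle x,y\rangle=-x_0y_0+\sum_{i=1}^{n-1}x_iy_i$ and Lebesgue measure. Let $\mathcal L_0$ be the connected component of the identity in the Lorentz group $\mathrm O(n-1,1)$ of this form. Let $\Omega$ be the set of locally finite subsets ("sprinklings") of $\mathbb M^n$, with the $\sigma$-algebra generated by the maps $\omega\mapsto\#(\omega\cap B)$, $B$ a bounded Borel set. Fix a point $p\in\mathbb M^n$ and let $\mathcal L_0$ act on $\mathbb M^n$ with $p$ as fixed point, $x\mapsto p+\Lambda(x-p)$, and hence on $\Omega$; we write $\Lambda\omega$ for the image of $\omega$. Let $\mathcal H=\{x:\langle x,x\rangle=-1,\ x_0>0\}$ be the hyperboloid of unit future-timelike vectors and $\mathcal S=\{x:\langle x,x\rangle=1\}$ the hyperboloid of unit spacelike vectors, on both of which $\mathcal L_0$ acts linearly. Let $X$ be any one of the following spaces: (a) $X=\mathcal S$ (spacelike directions); (b) $X=\prod_{i=1}^k X_i$ with $k\ge1$ and each $X_i\in\{\mathcal H,\mathcal S\}$, with the product $\sigma$-algebra and the diagonal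 action of $\mathcal L_0$ (finite tuples of timelike and/or spacelike directions, such as reference frames); (c) $X=\bigl(\prod_{i=1}^k X_i\bigr)/G$ with $\prod_i X_i$ as in (b) and $G$ a group of permutations of $\{1,\dots,k\}$, each of which only permutes factors of the same kind, with the quotient $\sigma$-algebra and the induced action (finite sets of directions). Then: (i) there is no $\mathcal L_0$-invariant probability measure on $X$; (ii) there is no measurable map $D:\Omega\to X$ with $D(\Lambda\omega)=\Lambda D(\omega)$ for all $\Lambda\in\mathcal L_0$ and $\omega\in\Omega$; (iii) more strongly, let $\mu$ be the law on $\Omega$ of a Poisson process of density $\rho>0$, that is, a probability measure under which $\#(\omega\cap B)$ is Poisson distributed with mean $\rho\,\mathrm{vol}(B)$ for every bounded Borel set $B$ and the numbers of points in finitely many pairwise disjoint such sets are independent. Then there is no measurable $\mathcal L_0$-invariant set $A\subseteq\Omega$ with $\mu(A)>0$ that admits a measurable map $D:A\to X$ with $D(\Lambda\omega)=\Lambda D(\omega)$ for all $\Lambda\in\mathcal L_0$ and $\omega\in A$. -/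

import Mathlib

open MeasureTheory ProbabilityTheory
open scoped NNReal Matrix

/-- Minkowski space of dimension `d + 1`; coordinate `0` is time.  Its volume element is Lebesgue
measure, the canonical `volume` of this type. -/
abbrev Mink (d : ℕ) : Type := Fin (d + 1) → ℝ

/-- The Minkowski inner product, of signature `(-, +, …, +)`. -/
def minkForm {d : ℕ} (x y : Mink d) : ℝ :=
  -(x 0 * y 0) + ∑ i : Fin d, x i.succ * y i.succ

/-- The full Lorentz group `O(d, 1)`, as a (topological) subgroup of `GL(d + 1, ℝ)`. -/
def fullLorentzGroup (d : ℕ) : Subgroup (GL (Fin (d + 1)) ℝ) where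
  carrier := {Λ | ∀ x y : Mink d, minkForm (Λ.val *ᵥ x) (Λ.val *ᵥ y) = minkForm x y}
  one_mem' := by intro x y; simp
  mul_mem' := by
    intro a b ha hb x y
    rw [Units.val_mul, ← Matrix.mulVec_mulVec, ← Matrix.mulVec_mulVec, ha, hb]
  inv_mem' := by
    intro a ha x y
    rw [← ha, Matrix.mulVec_mulVec, Matrix.mulVec_mulVec, Units.mul_inv, Matrix.one_mulVec,
      Matrix.one_mulVec]

/-- The connected component of the identity in `O(d, 1)`. -/
abbrev LorentzGroup (d : ℕ) : Type :=
  Subgroup.connectedComponentOfOne (fullLorentzGroup d)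

/-- The linear action of a Lorentz transformation on vectors. -/
def lorentzVec {d : ℕ} (Λ : LorentzGroup d) (x : Mink d) : Mink d :=
  Λ.val.val.val *ᵥ x

/-- The action of a Lorentz transformation on spacetime points with fixed point `p`. -/
def lorentzAt {d : ℕ} (p : Mink d) (Λ : LorentzGroup d) (x : Mink d) : Mink d :=
  p + lorentzVec Λ (x - p)

theorem lorentzVec_one {d : ℕ} (x : Mink d) : lorentzVec 1 x = x := by
  simp [lorentzVec]

theorem lorentzVec_mul {d : ℕ} (Λ Λ' : LorentzGroup d) (x : Mink d) :
    lorentzVec (Λ * Λ') x = lorentzVec Λ (lorentzVec Λ' x) := by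
  simp [lorentzVec, Matrix.mulVec_mulVec]

theorem minkForm_lorentzVec {d : ℕ} (Λ : LorentzGroup d) (x y : Mink d) :
    minkForm (lorentzVec Λ x) (lorentzVec Λ y) = minkForm x y :=
  Λ.val.property x y

theorem continuous_lorentzAt {d : ℕ} (p : Mink d) (Λ : LorentzGroup d) :
    Continuous (lorentzAt p Λ) := by
  unfold lorentzAt lorentzVec
  fun_prop

theorem lorentzAt_inv {d : ℕ} (p : Mink d) (Λ : LorentzGroup d) (x : Mink d) :
    lorentzAt p Λ⁻¹ (lorentzAt p Λ x) = x := by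
  simp [lorentzAt, ← lorentzVec_mul, lorentzVec_one]

/-! ### Directions -/

/-- The two kinds of directions. -/
inductive DirKind
  | timelike
  | spacelike

/-- The hyperboloid of unit future-timelike vectors, respectively of unit spacelike vectors. -/
def hyperboloid (d : ℕ) : DirKind → Set (Mink d)
  | .timelike => {x | minkForm x x = -1 ∧ 0 < x 0}
  | .spacelike => {x | minkForm x x = 1}

/-- The identity component of the Lorentz group preserves both hyperboloids. -/
theorem lorentzVec_mem_hyperboloid {d : ℕ} (Λ : LorentzGroup d) (κ : DirKind) {x : Mink d}
    (hx : x ∈ hyperboloid d κ) : lorentzVec Λ x ∈ hyperboloid d κ := by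
  cases κ with
  | spacelike => exact (minkForm_lorentzVec Λ x x).trans hx
  | timelike =>
    refine ⟨(minkForm_lorentzVec Λ x x).trans hx.1, ?_⟩
    by_contra! hneg
    have hconn : IsPreconnected (Set.univ : Set (LorentzGroup d)) := by
      have h : IsPreconnected (connectedComponent (1 : fullLorentzGroup d)) :=
        isPreconnected_connectedComponent
      exact (isPreconnected_iff_preconnectedSpace.mp h).isPreconnected_univ
    have hcont : Continuous fun Λ : LorentzGroup d => lorentzVec Λ x 0 := by
      have h1 : Continuous fun Λ : LorentzGroup d => Λ.val.val.val :=
        Units.continuous_val.comp (continuous_subtype_val.comp continuous_subtype_val)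
      exact (continuous_apply 0).comp (h1.matrix_mulVec continuous_const)
    obtain ⟨Λ₀, -, h0⟩ := hconn.intermediate_value (Set.mem_univ Λ) (Set.mem_univ 1)
      hcont.continuousOn ⟨hneg, by simpa [lorentzVec_one] using hx.2.le⟩
    have h2 := (minkForm_lorentzVec Λ₀ x x).trans hx.1
    have h3 : 0 ≤ ∑ i : Fin d, lorentzVec Λ₀ x i.succ * lorentzVec Λ₀ x i.succ :=
      Finset.sum_nonneg fun i _ => mul_self_nonneg _
    simp only [minkForm] at h2
    simp only at h0
    rw [h0] at h2
    linarith

/-- The Lorentz group acts on each hyperboloid. -/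
instance hyperboloidAction (d : ℕ) (κ : DirKind) :
    MulAction (LorentzGroup d) (hyperboloid d κ) where
  smul Λ x := ⟨lorentzVec Λ x.val, lorentzVec_mem_hyperboloid Λ κ x.property⟩
  one_smul x := Subtype.ext (lorentzVec_one x.val)
  mul_smul Λ Λ' x := Subtype.ext (lorentzVec_mul Λ Λ' x.val)

/-- The product of `k` copies of the two hyperboloids, the `i`-th factor being of kind `τ i`, with
the product `σ`-algebra and the diagonal action of the Lorentz group. -/
abbrev DirTuple (d : ℕ) {k : ℕ} (τ : Fin k → DirKind) : Type :=
  (i : Fin k) → hyperboloid d (τ i)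

/-- Two tuples of directions are equivalent if a permutation in `G` of the entries carries one into
the other. -/
def permSetoid (d : ℕ) {k : ℕ} (τ : Fin k → DirKind) (G : Subgroup (Equiv.Perm (Fin k))) :
    Setoid (DirTuple d τ) where
  r v w := ∃ g ∈ G, ∀ i, (w i : Mink d) = v (g i)
  iseqv :=
    { refl := fun v => ⟨1, G.one_mem, fun _ => rfl⟩
      symm := by
        rintro v w ⟨g, hg, h⟩
        exact ⟨g⁻¹, G.inv_mem hg, fun i => by
          have key : ∀ j, j = i → (v i : Mink d) = v j := by rintro _ rfl; rfl
          exact (key _ (g.apply_symm_apply i)).trans (h _).symm⟩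
      trans := by
        rintro u v w ⟨g, hg, h⟩ ⟨g', hg', h'⟩
        exact ⟨g * g', G.mul_mem hg hg', fun i => by simp [h, h']⟩ }

/-- The quotient of the product of hyperboloids by the permutation group `G`, with the quotient
`σ`-algebra. -/
abbrev DirQuotient (d : ℕ) {k : ℕ} (τ : Fin k → DirKind) (G : Subgroup (Equiv.Perm (Fin k))) :
    Type :=
  Quotient (permSetoid d τ G)

/-- The Lorentz group acts on the quotient through representatives. -/
instance dirQuotientAction (d : ℕ) {k : ℕ} (τ : Fin k → DirKind)
    (G : Subgroup (Equiv.Perm (Fin k))) : MulAction (LorentzGroup d) (DirQuotient d τ G) where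
  smul Λ := Quotient.map (fun v => Λ • v) (by
    rintro v w ⟨g, hg, h⟩
    exact ⟨g, hg, fun i => congrArg (lorentzVec Λ) (h i)⟩)
  one_smul q := by
    induction q using Quotient.inductionOn with
    | h v => exact congrArg (Quotient.mk _) (one_smul (LorentzGroup d) v)
  mul_smul Λ Λ' q := by
    induction q using Quotient.inductionOn with
    | h v => exact congrArg (Quotient.mk _) (mul_smul Λ Λ' v)

/-! ### Sprinklings -/

/-- The space of possible sprinklings: the locally finite subsets of Minkowski space. -/
def Sprinkling (d : ℕ) : Type :=
  {ω : Set (Mink d) // ∀ K : Set (Mink d), IsCompact K → (ω ∩ K).Finite}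

/-- The number of sprinkled points in the region `B` (finite whenever `B` is bounded). -/
noncomputable def Sprinkling.count {d : ℕ} (B : Set (Mink d)) (ω : Sprinkling d) : ℕ :=
  (ω.val ∩ B).ncard

/-- The `σ`-algebra generated by the numbers of points in bounded Borel regions. -/
noncomputable instance sprinklingMeasurableSpace (d : ℕ) : MeasurableSpace (Sprinkling d) :=
  ⨆ B : {B : Set (Mink d) // MeasurableSet B ∧ Bornology.IsBounded B},
    MeasurableSpace.comap (Sprinkling.count B.val) ⊤

/-- The action of the Lorentz group on sprinklings, with fixed point `p`. -/
def Sprinkling.act {d : ℕ} (p : Mink d) (Λ : LorentzGroup d) (ω : Sprinkling d) :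
    Sprinkling d :=
  ⟨lorentzAt p Λ '' ω.val, by
    intro K hK
    refine ((ω.property _ (hK.image (continuous_lorentzAt p Λ⁻¹))).image (lorentzAt p Λ)).subset ?_
    rintro _ ⟨⟨x, hx, rfl⟩, hxK⟩
    exact ⟨x, ⟨hx, lorentzAt p Λ x, hxK, lorentzAt_inv p Λ x⟩, rfl⟩⟩

/-- `μ` is the law of the Poisson process of density `ρ`: the number of points in a bounded Borel
region of volume `V` is Poisson distributed with mean `ρ V`, and the numbers of points in finitely
many pairwise disjoint such regions are independent. -/
structure IsPoissonSprinkling {d : ℕ} (ρ : ℝ≥0) (μ : Measure (Sprinkling d)) : Prop where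
  isProbabilityMeasure : IsProbabilityMeasure μ
  map_count : ∀ B : Set (Mink d), MeasurableSet B → Bornology.IsBounded B →
    μ.map (Sprinkling.count B) = poissonMeasure (ρ * (volume B).toNNReal)
  indep : ∀ (m : ℕ) (B : Fin m → Set (Mink d)), (∀ i, MeasurableSet (B i)) →
    (∀ i, Bornology.IsBounded (B i)) → Pairwise (fun i j => Disjoint (B i) (B j)) →
    iIndepFun (fun i => Sprinkling.count (B i)) μ

/-! ### The impossibility assertions, for a target space `X` with an action of the Lorentz group -/

/-- There is a measurable map `D` from all sprinklings to `X` that commutes with the Lorentz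
transformations about `p`. -/
def HasEquivariantMap {d : ℕ} (p : Mink d) (X : Type) [MeasurableSpace X]
    [MulAction (LorentzGroup d) X] : Prop :=
  ∃ D : Sprinkling d → X, Measurable D ∧
    ∀ (Λ : LorentzGroup d) (ω : Sprinkling d), D (ω.act p Λ) = Λ • D ω

/-- There is a measurable map `D` to `X`, defined on a measurable set `A` of sprinklings that has
nonzero measure under `μ`, that commutes with the Lorentz transformations about `p` (in particular
`A` is invariant). -/
def HasPartialEquivariantMap {d : ℕ} (p : Mink d) (μ : Measure (Sprinkling d)) (X : Type)
    [MeasurableSpace X] [MulAction (LorentzGroup d) X] : Prop :=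
  ∃ (A : Set (Sprinkling d)) (D : A → X), MeasurableSet A ∧ μ A ≠ 0 ∧ Measurable D ∧
    ∀ (Λ : LorentzGroup d) (ω : A), ∃ h : ω.val.act p Λ ∈ A, D ⟨ω.val.act p Λ, h⟩ = Λ • D ω

/-- There is a Lorentz invariant probability measure on `X`. -/
def HasInvariantProbability (d : ℕ) (X : Type) [MeasurableSpace X]
    [MulAction (LorentzGroup d) X] : Prop :=
  ∃ ν : Measure X, IsProbabilityMeasure ν ∧ SMulInvariantMeasure (LorentzGroup d) X ν

/-- `X`-valued data at `p` cannot be associated to sprinklings: no invariant probability measure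
exists on `X`, no equivariant measurable map from sprinklings to `X` exists, and none exists even on
a set of sprinklings of nonzero measure under a Poisson process. -/
structure NotDeterminedBySprinklings {d : ℕ} (p : Mink d) (X : Type) [MeasurableSpace X]
    [MulAction (LorentzGroup d) X] : Prop where
  no_invariant_probability : ¬ HasInvariantProbability d X
  no_map : ¬ HasEquivariantMap p X
  no_partial_map : ∀ ρ : ℝ≥0, 0 < ρ → ∀ μ : Measure (Sprinkling d), IsPoissonSprinkling ρ μ →
    ¬ HasPartialEquivariantMap p μ X

/-! Everything reduces to (i). An equivariant measurable map pushes an invariant law on its domain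
forward to an invariant probability on `X`. On all of `Ω` the Dirac mass at the empty sprinkling is
such a law; on an invariant set `A` with `μ A ≠ 0` it is `μ` restricted to `A` and normalized
(`HasPartialEquivariantMap.hasInvariantProbability`).

For (i), a boost along a spatial axis multiplies one of the null coordinates `x₀ ± xⱼ` by `2`. A
finite measure preserved by a map that doubles a nonnegative function `f` must live on `f = 0`
(`ae_eq_zero_of_doubling`), since `{c < f}` and `{2ⁿ c < f}` have the same mass. A hyperboloid
contains no vector whose null coordinates all vanish, so no invariant probability is left. For
tuples and their quotients, `f` is the sum of the absolute values of a null coordinate over the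
entries, which no permutation changes.

The Poisson law is invariant because its image under a Lorentz transformation is again Poisson of
the same density, volume being preserved, and there is only one such law
(`IsPoissonSprinkling.unique`). -/

/-! ### Boosts -/

/-- The matrix of the boost of rapidity `t` along the `j`-th spatial axis. -/
noncomputable def boostMatrix {d : ℕ} (j : Fin d) (t : ℝ) : Matrix (Fin (d + 1)) (Fin (d + 1)) ℝ :=
  1 + (Real.cosh t - 1) • (Matrix.single 0 0 1 + Matrix.single j.succ j.succ 1) +
    Real.sinh t • (Matrix.single 0 j.succ 1 + Matrix.single j.succ 0 1)

theorem boostMatrix_mulVec_zero {d : ℕ} (j : Fin d) (t : ℝ) (x : Mink d) :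
    (boostMatrix j t *ᵥ x) 0 = Real.cosh t * x 0 + Real.sinh t * x j.succ := by
  simp [boostMatrix, Matrix.add_mulVec, Matrix.single_mulVec, (Fin.succ_ne_zero j).symm]
  ring

theorem boostMatrix_mulVec_succ_self {d : ℕ} (j : Fin d) (t : ℝ) (x : Mink d) :
    (boostMatrix j t *ᵥ x) j.succ = Real.sinh t * x 0 + Real.cosh t * x j.succ := by
  simp [boostMatrix, Matrix.add_mulVec, Matrix.single_mulVec]
  ring

theorem boostMatrix_mulVec_succ_of_ne {d : ℕ} {i j : Fin d} (h : i ≠ j) (t : ℝ) (x : Mink d) :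
    (boostMatrix j t *ᵥ x) i.succ = x i.succ := by
  simp [boostMatrix, Matrix.add_mulVec, Matrix.single_mulVec, h]

theorem boostMatrix_mul_neg {d : ℕ} (j : Fin d) (t : ℝ) :
    boostMatrix j t * boostMatrix j (-t) = 1 := by
  refine Matrix.ext_of_mulVec_single fun i => ?_
  rw [← Matrix.mulVec_mulVec, Matrix.one_mulVec]
  generalize (Pi.single i 1 : Mink d) = x
  have h := Real.cosh_sq_sub_sinh_sq t
  ext k
  refine Fin.cases ?_ (fun k => ?_) k
  · rw [boostMatrix_mulVec_zero, boostMatrix_mulVec_zero, boostMatrix_mulVec_succ_self,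
      Real.cosh_neg, Real.sinh_neg]
    linear_combination x 0 * h
  · by_cases hk : k = j
    · subst hk
      rw [boostMatrix_mulVec_succ_self, boostMatrix_mulVec_zero, boostMatrix_mulVec_succ_self,
        Real.cosh_neg, Real.sinh_neg]
      linear_combination x k.succ * h
    · rw [boostMatrix_mulVec_succ_of_ne hk, boostMatrix_mulVec_succ_of_ne hk]

theorem minkForm_boostMatrix {d : ℕ} (j : Fin d) (t : ℝ) (x y : Mink d) :
    minkForm (boostMatrix j t *ᵥ x) (boostMatrix j t *ᵥ y) = minkForm x y := by
  have h := Real.cosh_sq_sub_sinh_sq t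
  have hrest : ∑ i ∈ Finset.univ.erase j,
        (boostMatrix j t *ᵥ x) i.succ * (boostMatrix j t *ᵥ y) i.succ =
      ∑ i ∈ Finset.univ.erase j, x i.succ * y i.succ :=
    Finset.sum_congr rfl fun i hi => by
      rw [boostMatrix_mulVec_succ_of_ne (Finset.ne_of_mem_erase hi),
        boostMatrix_mulVec_succ_of_ne (Finset.ne_of_mem_erase hi)]
  rw [minkForm, minkForm, ← Finset.add_sum_erase _ _ (Finset.mem_univ j),
    ← Finset.add_sum_erase _ (fun i : Fin d => x i.succ * y i.succ) (Finset.mem_univ j), hrest,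
    boostMatrix_mulVec_zero, boostMatrix_mulVec_zero, boostMatrix_mulVec_succ_self,
    boostMatrix_mulVec_succ_self]
  linear_combination (x j.succ * y j.succ - x 0 * y 0) * h

theorem continuous_boostMatrix {d : ℕ} (j : Fin d) : Continuous (boostMatrix j) := by
  unfold boostMatrix
  fun_prop

/-- The boost of rapidity `t` along the `j`-th spatial axis, in the full Lorentz group. -/
noncomputable def fullBoost {d : ℕ} (j : Fin d) (t : ℝ) : fullLorentzGroup d :=
  ⟨⟨boostMatrix j t, boostMatrix j (-t), boostMatrix_mul_neg j t, by
    simpa using boostMatrix_mul_neg j (-t)⟩, minkForm_boostMatrix j t⟩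

theorem continuous_fullBoost {d : ℕ} (j : Fin d) : Continuous (fullBoost j) := by
  refine Continuous.subtype_mk (Units.continuous_iff.mpr ⟨?_, ?_⟩) _
  · exact continuous_boostMatrix j
  · exact (continuous_boostMatrix j).comp continuous_neg

theorem fullBoost_zero {d : ℕ} (j : Fin d) : fullBoost j 0 = 1 :=
  Subtype.ext (Units.ext (by simp [fullBoost, boostMatrix]))

/-- The boost of rapidity `t` along the `j`-th spatial axis. -/
noncomputable def boost {d : ℕ} (j : Fin d) (t : ℝ) : LorentzGroup d :=
  -- The boosts along one axis form a connected set through the identity, reached at rapidity `0`.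
  ⟨fullBoost j t, (isPreconnected_range (continuous_fullBoost j)).subset_connectedComponent
    ⟨0, fullBoost_zero j⟩ ⟨t, rfl⟩⟩

/-- The null coordinate `x₀ + xⱼ` or `x₀ - xⱼ`. -/
def nullCoord {d : ℕ} (j : Fin d) (b : Bool) (x : Mink d) : ℝ :=
  x 0 + cond b (x j.succ) (-x j.succ)

theorem measurable_nullCoord {d : ℕ} (j : Fin d) (b : Bool) :
    Measurable (nullCoord (d := d) j b) := by
  unfold nullCoord
  cases b <;> simp only [cond_true, cond_false] <;> fun_prop

/-- The boost that multiplies a given null coordinate by `2`. -/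
noncomputable def doublingBoost {d : ℕ} (j : Fin d) (b : Bool) : LorentzGroup d :=
  boost j (cond b (Real.log 2) (-Real.log 2))

/-- The null coordinates `x₀ ± xⱼ` are eigenfunctions of the boost of rapidity `t`, with eigenvalues
`exp (±t)`; the sign of `t = ±log 2` is chosen to make the eigenvalue `2`. -/
theorem nullCoord_doublingBoost {d : ℕ} (j : Fin d) (b : Bool) (x : Mink d) :
    nullCoord j b (lorentzVec (doublingBoost j b) x) = 2 * nullCoord j b x := by
  have h2 : Real.cosh (Real.log 2) + Real.sinh (Real.log 2) = 2 := by
    rw [Real.cosh_add_sinh, Real.exp_log two_pos]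
  change (boostMatrix j _ *ᵥ x) 0 + cond b ((boostMatrix j _ *ᵥ x) j.succ)
    (-(boostMatrix j _ *ᵥ x) j.succ) = 2 * (x 0 + cond b (x j.succ) (-x j.succ))
  rw [boostMatrix_mulVec_zero, boostMatrix_mulVec_succ_self]
  cases b
  · simp only [cond_false, Real.cosh_neg, Real.sinh_neg]
    linear_combination (x 0 - x j.succ) * h2
  · simp only [cond_true]
    linear_combination (x 0 + x j.succ) * h2

/-- No vector of either hyperboloid has only vanishing null coordinates. -/
theorem exists_nullCoord_ne_zero {d : ℕ} (hd : 0 < d) {κ : DirKind} {x : Mink d}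
    (hx : x ∈ hyperboloid d κ) : ∃ (j : Fin d) (b : Bool), nullCoord j b x ≠ 0 := by
  by_contra! h
  have hcoord : ∀ j : Fin d, x 0 = 0 ∧ x j.succ = 0 := fun j => by
    have h1 := h j true
    have h2 := h j false
    simp only [nullCoord, cond_true, cond_false] at h1 h2
    constructor <;> linarith
  -- Control of `x 0` requires at least one spatial axis, hence `hd`.
  have hform : minkForm x x = 0 := by
    simp [minkForm, (hcoord ⟨0, hd⟩).1, fun j => (hcoord j).2]
  cases κ with
  | timelike => linarith [hform.symm.trans hx.1]
  | spacelike => linarith [hform.symm.trans hx]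

/-! ### Lorentz transformations preserve volume -/

/-- The Gram matrix of the Minkowski form. -/
def minkMatrix (d : ℕ) : Matrix (Fin (d + 1)) (Fin (d + 1)) ℝ :=
  Matrix.diagonal (Fin.cons (-1) fun _ => 1)

theorem minkForm_eq_dotProduct {d : ℕ} (x y : Mink d) :
    minkForm x y = x ⬝ᵥ (minkMatrix d *ᵥ y) := by
  simp [minkForm, minkMatrix, dotProduct, Matrix.mulVec_diagonal, Fin.sum_univ_succ]

/-- Take determinants in `Mᵀ η M = η`, where `η` is the invertible Gram matrix. -/
theorem abs_det_eq_one {d : ℕ} (Λ : LorentzGroup d) : |Λ.val.val.val.det| = 1 := by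
  set M := Λ.val.val.val with hM
  have h : Mᵀ * minkMatrix d * M = minkMatrix d := by
    ext i j
    have := minkForm_lorentzVec Λ (Pi.single i 1) (Pi.single j 1)
    rw [minkForm_eq_dotProduct, minkForm_eq_dotProduct, lorentzVec, lorentzVec, ← hM,
      Matrix.dotProduct_mulVec, Matrix.vecMul_mulVec, ← Matrix.dotProduct_mulVec,
      Matrix.mulVec_mulVec] at this
    simpa using this
  have hdet := congrArg Matrix.det h
  have hη : (minkMatrix d).det ≠ 0 := by
    simp [minkMatrix, Matrix.det_diagonal, Fin.prod_univ_succ]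
  rw [Matrix.det_mul, Matrix.det_mul, Matrix.det_transpose] at hdet
  have hsq : M.det * M.det = 1 := mul_right_cancel₀ hη (by linear_combination hdet)
  rcases mul_self_eq_one_iff.mp hsq with h1 | h1 <;> simp [h1]

theorem volume_preimage_lorentzAt {d : ℕ} (p : Mink d) (Λ : LorentzGroup d) (B : Set (Mink d)) :
    volume (lorentzAt p Λ ⁻¹' B) = volume B := by
  have hdet : LinearMap.det (Matrix.toLin' Λ.val.val.val) ≠ 0 := by
    rw [LinearMap.det_toLin']
    intro h
    simpa [h] using abs_det_eq_one Λ
  have hset : lorentzAt p Λ ⁻¹' B =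
      (fun x => x + -p) ⁻¹' (Matrix.toLin' Λ.val.val.val ⁻¹' ((fun x => p + x) ⁻¹' B)) := by
    ext x
    simp [lorentzAt, lorentzVec, sub_eq_add_neg]
  rw [hset, measure_preimage_add_right, Measure.addHaar_preimage_linearMap _ hdet,
    measure_preimage_add, LinearMap.det_toLin', abs_inv, abs_det_eq_one]
  simp

/-! ### Scaling functions and invariant probabilities -/

/-- If the transformation `T` preserves a finite measure and doubles the nonnegative function `f`,
then `f` vanishes almost everywhere. -/
theorem ae_eq_zero_of_doubling {X : Type*} [MeasurableSpace X] {ν : Measure X} [IsFiniteMeasure ν]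
    {T : X → X} (hT : ∀ s, MeasurableSet s → ν (T ⁻¹' s) = ν s) {f : X → ℝ} (hf : Measurable f)
    (h0 : ∀ x, 0 ≤ f x) (hfT : ∀ x, f (T x) = 2 * f x) : ∀ᵐ x ∂ν, f x = 0 := by
  have hmeas : ∀ c : ℝ, MeasurableSet {x | c < f x} := fun c => hf measurableSet_Ioi
  have hstep : ∀ c : ℝ, ν {x | c < f x} = ν {x | 2 * c < f x} := fun c => by
    rw [← hT _ (hmeas (2 * c))]
    congr 1
    ext x
    simp [hfT]
  have hpow : ∀ (c : ℝ) (n : ℕ), ν {x | 2 ^ n * c < f x} = ν {x | c < f x} := fun c n => by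
    induction n with
    | zero => simp
    | succ n ih => rw [← ih, hstep (2 ^ n * c), pow_succ' (2 : ℝ) n, mul_assoc]
  have hzero : ∀ c : ℝ, 0 < c → ν {x | c < f x} = 0 := fun c hc => by
    -- These sets decrease to `∅` because `f` is finite everywhere. Continuity from above, valid for
    -- a finite measure, sends their constant mass to `0`.
    have hlim : Filter.Tendsto (fun n : ℕ => ν {x | 2 ^ n * c < f x}) Filter.atTop
        (nhds (ν (⋂ n : ℕ, {x | 2 ^ n * c < f x}))) := by
      refine tendsto_measure_iInter_atTop (fun n => (hmeas _).nullMeasurableSet) ?_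
        ⟨0, measure_ne_top _ _⟩
      intro m n hmn x (hx : 2 ^ n * c < f x)
      have : (2 : ℝ) ^ m ≤ 2 ^ n := pow_le_pow_right₀ one_le_two hmn
      exact lt_of_le_of_lt (by gcongr) hx
    have hempty : (⋂ n : ℕ, {x | 2 ^ n * c < f x}) = ∅ := by
      refine Set.eq_empty_of_forall_notMem fun x hx => ?_
      obtain ⟨n, hn⟩ := pow_unbounded_of_one_lt (f x / c) one_lt_two
      have h1 : 2 ^ n * c < f x := Set.mem_iInter.mp hx n
      rw [div_lt_iff₀ hc] at hn
      exact lt_asymm h1 hn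
    simp only [hpow, hempty, measure_empty] at hlim
    exact tendsto_nhds_unique tendsto_const_nhds hlim
  have hall : ∀ᵐ x ∂ν, ∀ n : ℕ, ¬ (1 / ((n : ℝ) + 1) < f x) :=
    ae_all_iff.mpr fun n => by
      rw [ae_iff]
      simpa only [not_not] using hzero _ Nat.one_div_pos_of_nat
  filter_upwards [hall] with x hx
  refine le_antisymm (le_of_not_gt fun hpos => ?_) (h0 x)
  obtain ⟨n, hn⟩ := exists_nat_one_div_lt hpos
  exact hx n hn

/-- A space on which every point is seen by one of countably many measurable nonnegative functions,
each of which is doubled by some Lorentz transformation, carries no invariant probability. -/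
theorem not_hasInvariantProbability_of_doubling {d : ℕ} {X : Type} [MeasurableSpace X]
    [MulAction (LorentzGroup d) X] {ι : Type*} [Countable ι] (f : ι → X → ℝ)
    (Λ : ι → LorentzGroup d) (hf : ∀ i, Measurable (f i)) (h0 : ∀ i x, 0 ≤ f i x)
    (hfΛ : ∀ i x, f i (Λ i • x) = 2 * f i x) (hne : ∀ x, ∃ i, f i x ≠ 0) :
    ¬ HasInvariantProbability d X := by
  rintro ⟨ν, hν, hinv⟩
  have hall : ∀ᵐ x ∂ν, ∀ i, f i x = 0 := ae_all_iff.mpr fun i =>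
    ae_eq_zero_of_doubling (fun s hs => hinv.measure_preimage_smul (Λ i) hs) (hf i) (h0 i) (hfΛ i)
  obtain ⟨x, hx⟩ := hall.exists
  obtain ⟨i, hi⟩ := hne x
  exact hi (hx i)

/-! ### Counts of sprinkled points -/

namespace Sprinkling

theorem finite_inter {d : ℕ} (ω : Sprinkling d) {B : Set (Mink d)} (hB : Bornology.IsBounded B) :
    (ω.val ∩ B).Finite :=
  (ω.property _ hB.isCompact_closure).subset (Set.inter_subset_inter_right _ subset_closure)

theorem measurable_count {d : ℕ} {B : Set (Mink d)} (hB : MeasurableSet B)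
    (hb : Bornology.IsBounded B) : Measurable (count B) :=
  Measurable.of_comap_le
    (le_iSup (fun B : {B : Set (Mink d) // MeasurableSet B ∧ Bornology.IsBounded B} =>
      MeasurableSpace.comap (count B.val) ⊤) ⟨B, hB, hb⟩)

/-- The numbers of points in all bounded Borel regions. -/
noncomputable def counts {d : ℕ} (ω : Sprinkling d) :
    {B : Set (Mink d) // MeasurableSet B ∧ Bornology.IsBounded B} → ℕ :=
  fun B => count B.val ω

/-- A law on sprinklings is thus determined by the joint law of all counts, a measure on a product
space. -/
theorem measurableSpace_eq_comap_counts (d : ℕ) :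
    sprinklingMeasurableSpace d = MeasurableSpace.comap counts MeasurableSpace.pi := by
  simp only [MeasurableSpace.pi, MeasurableSpace.comap_iSup, MeasurableSpace.comap_comp]
  rfl

theorem measurable_counts {d : ℕ} : Measurable (counts (d := d)) :=
  measurable_pi_lambda _ fun B => measurable_count B.property.1 B.property.2

/-- The points that lie in exactly those regions whose index belongs to the nonempty set `S`. -/
def atom {d : ℕ} {ι : Type*} (B : ι → Set (Mink d)) (S : Finset ι) : Set (Mink d) :=
  {x | S.Nonempty ∧ ∀ i, x ∈ B i ↔ i ∈ S}

theorem measurableSet_atom {d : ℕ} {ι : Type*} [Countable ι] {B : ι → Set (Mink d)}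
    (hB : ∀ i, MeasurableSet (B i)) (S : Finset ι) : MeasurableSet (atom B S) := by
  have h : atom B S = {_x | S.Nonempty} ∩ ⋂ i, {x | x ∈ B i ↔ i ∈ S} := by
    ext x
    simp [atom]
  rw [h]
  exact (MeasurableSet.const _).inter
    (MeasurableSet.iInter fun i => MeasurableSet.iff (hB i) (MeasurableSet.const _))

/-- This is why `atom` demands that `S` be nonempty: the points outside all regions need not form a
bounded set. -/
theorem isBounded_atom {d : ℕ} {ι : Type*} {B : ι → Set (Mink d)}
    (hB : ∀ i, Bornology.IsBounded (B i)) (S : Finset ι) : Bornology.IsBounded (atom B S) := by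
  rcases S.eq_empty_or_nonempty with rfl | ⟨i, hi⟩
  · simp [atom]
  · exact (hB i).subset fun x hx => (hx.2 i).mpr hi

theorem disjoint_atom {d : ℕ} {ι : Type*} (B : ι → Set (Mink d)) {S T : Finset ι} (h : S ≠ T) :
    Disjoint (atom B S) (atom B T) :=
  Set.disjoint_left.mpr fun _ hS hT => h (Finset.ext fun i => (hS.2 i).symm.trans (hT.2 i))

/-- Sort the points `x` of `B i` by the set of all `j` with `x ∈ B j`. -/
theorem count_eq_sum_atom {d : ℕ} {ι : Type*} [Fintype ι] [DecidableEq ι] {B : ι → Set (Mink d)}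
    (hB : ∀ i, Bornology.IsBounded (B i)) (i : ι) (ω : Sprinkling d) :
    count (B i) ω = ∑ S : Finset ι, if i ∈ S then count (atom B S) ω else 0 := by
  classical
  have hfin := ω.finite_inter (hB i)
  rw [count, Set.ncard_eq_toFinset_card _ hfin,
    Finset.card_eq_sum_card_fiberwise (f := fun x => Finset.univ.filter fun j => x ∈ B j)
      (t := Finset.univ) fun _ _ => Finset.mem_coe.mpr (Finset.mem_univ _)]
  refine Finset.sum_congr rfl fun S _ => ?_
  split_ifs with hi
  · rw [count, ← Set.ncard_coe_finset]
    congr 1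
    ext x
    simp only [Finset.coe_filter, Set.Finite.mem_toFinset, Set.mem_inter_iff, Set.mem_ofPred_eq,
      atom, Finset.ext_iff, Finset.mem_filter, Finset.mem_univ, true_and]
    exact ⟨fun h => ⟨h.1.1, ⟨i, hi⟩, h.2⟩, fun h => ⟨⟨h.1, (h.2.2 i).mpr hi⟩, h.2.2⟩⟩
  · rw [Finset.card_eq_zero, Finset.filter_eq_empty_iff]
    rintro x hx rfl
    exact hi (by simpa using ((Set.Finite.mem_toFinset hfin).mp hx).2)

end Sprinkling

/-! ### Uniqueness and invariance of the Poisson law -/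

/-- The right side does not involve `μ`: on disjoint regions, independence and the Poisson marginals
fix the joint law. -/
theorem IsPoissonSprinkling.map_disjoint_counts {d : ℕ} {ρ : ℝ≥0} {μ : Measure (Sprinkling d)}
    (hμ : IsPoissonSprinkling ρ μ) {m : ℕ} {B : Fin m → Set (Mink d)}
    (hB : ∀ i, MeasurableSet (B i)) (hb : ∀ i, Bornology.IsBounded (B i))
    (hdisj : Pairwise fun i j => Disjoint (B i) (B j)) :
    μ.map (fun ω i => Sprinkling.count (B i) ω) =
      Measure.pi fun i => poissonMeasure (ρ * (volume (B i)).toNNReal) := by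
  have := hμ.isProbabilityMeasure
  rw [(iIndepFun_iff_map_fun_eq_pi_map fun i =>
    (Sprinkling.measurable_count (hB i) (hb i)).aemeasurable).mp (hμ.indep m B hB hb hdisj)]
  simp only [hμ.map_count _ (hB _) (hb _)]

/-- The joint law of the numbers of points in finitely many, possibly overlapping, bounded Borel
regions is the same under any two Poisson laws of the same density. -/
theorem IsPoissonSprinkling.map_finite_counts_eq {d : ℕ} {ρ : ℝ≥0} {μ ν : Measure (Sprinkling d)}
    (hμ : IsPoissonSprinkling ρ μ) (hν : IsPoissonSprinkling ρ ν) {ι : Type*} [Fintype ι]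
    {B : ι → Set (Mink d)} (hB : ∀ i, MeasurableSet (B i))
    (hb : ∀ i, Bornology.IsBounded (B i)) :
    μ.map (fun ω i => Sprinkling.count (B i) ω) = ν.map (fun ω i => Sprinkling.count (B i) ω) := by
  classical
  let e := (Fintype.equivFin (Finset ι)).symm
  let C : Fin (Fintype.card (Finset ι)) → Set (Mink d) := fun n => Sprinkling.atom B (e n)
  have hC : ∀ n, MeasurableSet (C n) := fun n => Sprinkling.measurableSet_atom hB _
  have hCb : ∀ n, Bornology.IsBounded (C n) := fun n => Sprinkling.isBounded_atom hb _
  have hCd : Pairwise fun i j => Disjoint (C i) (C j) := fun i j hij =>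
    Sprinkling.disjoint_atom B (e.injective.ne hij)
  -- Counts of overlapping regions are a fixed function `L` of the counts of the disjoint atoms.
  let L : (Fin (Fintype.card (Finset ι)) → ℕ) → ι → ℕ :=
    fun c i => ∑ n, if i ∈ e n then c n else 0
  have hL : Measurable L := measurable_of_countable L
  have hCm : Measurable fun (ω : Sprinkling d) n => Sprinkling.count (C n) ω :=
    measurable_pi_lambda _ fun n => Sprinkling.measurable_count (hC n) (hCb n)
  have hfac : (fun (ω : Sprinkling d) i => Sprinkling.count (B i) ω) =
      L ∘ fun ω n => Sprinkling.count (C n) ω := by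
    funext ω i
    exact (Sprinkling.count_eq_sum_atom hb i ω).trans
      (Equiv.sum_comp e fun S => if i ∈ S then Sprinkling.count (Sprinkling.atom B S) ω else 0).symm
  rw [hfac, ← Measure.map_map hL hCm, ← Measure.map_map hL hCm,
    hμ.map_disjoint_counts hC hCb hCd, hν.map_disjoint_counts hC hCb hCd]

/-- There is at most one Poisson law of given density. -/
theorem IsPoissonSprinkling.unique {d : ℕ} {ρ : ℝ≥0} {μ ν : Measure (Sprinkling d)}
    (hμ : IsPoissonSprinkling ρ μ) (hν : IsPoissonSprinkling ρ ν) : μ = ν := by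
  have := hμ.isProbabilityMeasure
  have hmap : μ.map Sprinkling.counts = ν.map Sprinkling.counts := by
    have hm := Sprinkling.measurable_counts (d := d)
    have : IsProbabilityMeasure (μ.map Sprinkling.counts) :=
      Measure.isProbabilityMeasure_map hm.aemeasurable
    have hr : ∀ I : Finset {B : Set (Mink d) // MeasurableSet B ∧ Bornology.IsBounded B},
        Measurable (I.restrict (π := fun _ => ℕ)) := fun I => Finset.measurable_restrict I
    -- A finite measure on a product is determined by its finite-dimensional marginals.
    refine IsProjectiveLimit.unique (P := fun I => (μ.map Sprinkling.counts).map I.restrict)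
      (fun _ => rfl) fun I => ?_
    change _ = (μ.map Sprinkling.counts).map I.restrict
    rw [Measure.map_map (hr I) hm, Measure.map_map (hr I) hm]
    exact (hμ.map_finite_counts_eq hν (B := fun B : I => B.val.val)
      (fun B => B.val.property.1) fun B => B.val.property.2).symm
  refine Measure.ext fun s hs => ?_
  rw [Sprinkling.measurableSpace_eq_comap_counts] at hs
  obtain ⟨t, ht, rfl⟩ := hs
  rw [← Measure.map_apply Sprinkling.measurable_counts ht, hmap,
    Measure.map_apply Sprinkling.measurable_counts ht]

theorem lorentzAt_injective {d : ℕ} (p : Mink d) (Λ : LorentzGroup d) :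
    Function.Injective (lorentzAt p Λ) :=
  Function.LeftInverse.injective (lorentzAt_inv p Λ)

theorem isBounded_preimage_lorentzAt {d : ℕ} (p : Mink d) (Λ : LorentzGroup d) {B : Set (Mink d)}
    (hB : Bornology.IsBounded B) : Bornology.IsBounded (lorentzAt p Λ ⁻¹' B) :=
  (hB.isCompact_closure.image (continuous_lorentzAt p Λ⁻¹)).isBounded.subset fun x hx =>
    ⟨lorentzAt p Λ x, subset_closure hx, lorentzAt_inv p Λ x⟩

theorem Sprinkling.count_act {d : ℕ} (p : Mink d) (Λ : LorentzGroup d) (B : Set (Mink d))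
    (ω : Sprinkling d) : count B (ω.act p Λ) = count (lorentzAt p Λ ⁻¹' B) ω := by
  change (lorentzAt p Λ '' ω.val ∩ B).ncard = (ω.val ∩ lorentzAt p Λ ⁻¹' B).ncard
  rw [← Set.image_inter_preimage, Set.ncard_image_of_injective _ (lorentzAt_injective p Λ)]

theorem Sprinkling.act_inv_act {d : ℕ} (p : Mink d) (Λ : LorentzGroup d) (ω : Sprinkling d) :
    (ω.act p Λ).act p Λ⁻¹ = ω :=
  Subtype.ext ((Set.image_image _ _ _).trans (by simp [lorentzAt_inv]))

theorem Sprinkling.measurable_act {d : ℕ} (p : Mink d) (Λ : LorentzGroup d) :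
    Measurable (Sprinkling.act p Λ) := by
  refine Measurable.of_le_map (iSup_le fun B => ?_)
  refine MeasurableSpace.comap_le_iff_le_map.mpr fun s hs => ?_
  change MeasurableSet ((fun ω : Sprinkling d => count B.val (ω.act p Λ)) ⁻¹' s)
  simp only [count_act]
  exact measurable_count ((continuous_lorentzAt p Λ).measurable B.property.1)
    (isBounded_preimage_lorentzAt p Λ B.property.2) hs

/-- Counting the transformed sprinkling in `B` is counting the original one in the preimage of `B`,
and preimages keep volume, boundedness and disjointness. -/
theorem IsPoissonSprinkling.map_act {d : ℕ} {ρ : ℝ≥0} {μ : Measure (Sprinkling d)}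
    (hμ : IsPoissonSprinkling ρ μ) (p : Mink d) (Λ : LorentzGroup d) :
    IsPoissonSprinkling ρ (μ.map (Sprinkling.act p Λ)) where
  isProbabilityMeasure := by
    have := hμ.isProbabilityMeasure
    exact Measure.isProbabilityMeasure_map (Sprinkling.measurable_act p Λ).aemeasurable
  map_count B hB hb := by
    rw [Measure.map_map (Sprinkling.measurable_count hB hb) (Sprinkling.measurable_act p Λ)]
    have : Sprinkling.count B ∘ Sprinkling.act p Λ = Sprinkling.count (lorentzAt p Λ ⁻¹' B) :=
      funext (Sprinkling.count_act p Λ B)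
    rw [this, hμ.map_count _ ((continuous_lorentzAt p Λ).measurable hB)
      (isBounded_preimage_lorentzAt p Λ hb), volume_preimage_lorentzAt]
  indep m B hB hb hdisj := by
    have := hμ.isProbabilityMeasure
    have hact := Sprinkling.measurable_act p Λ
    have := Measure.isProbabilityMeasure_map (μ := μ) hact.aemeasurable
    have hc : ∀ i, Measurable (Sprinkling.count (B i)) := fun i =>
      Sprinkling.measurable_count (hB i) (hb i)
    have hind := hμ.indep m (fun i => lorentzAt p Λ ⁻¹' B i)
      (fun i => (continuous_lorentzAt p Λ).measurable (hB i))
      (fun i => isBounded_preimage_lorentzAt p Λ (hb i)) fun i j hij => (hdisj hij).preimage _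
    have hcomp : ∀ i, Sprinkling.count (lorentzAt p Λ ⁻¹' B i) =
        Sprinkling.count (B i) ∘ Sprinkling.act p Λ := fun i =>
      funext fun ω => (Sprinkling.count_act p Λ (B i) ω).symm
    simp only [hcomp] at hind
    rw [iIndepFun_iff_map_fun_eq_pi_map fun i => ((hc i).comp hact).aemeasurable] at hind
    rw [iIndepFun_iff_map_fun_eq_pi_map fun i => (hc i).aemeasurable,
      Measure.map_map (measurable_pi_lambda _ hc) hact]
    simp only [Measure.map_map (hc _) hact]
    exact hind

/-- A Poisson law is Lorentz invariant. -/
theorem IsPoissonSprinkling.map_act_eq {d : ℕ} {ρ : ℝ≥0} {μ : Measure (Sprinkling d)}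
    (hμ : IsPoissonSprinkling ρ μ) (p : Mink d) (Λ : LorentzGroup d) :
    μ.map (Sprinkling.act p Λ) = μ :=
  (hμ.map_act p Λ).unique hμ

/-! ### Pushing invariant laws forward along equivariant maps -/

/-- The normalized restriction of an invariant law to the domain of a partial equivariant map is
carried by that map to an invariant probability. -/
theorem HasPartialEquivariantMap.hasInvariantProbability {d : ℕ} {p : Mink d}
    {μ : Measure (Sprinkling d)} [IsFiniteMeasure μ]
    (hμ : ∀ Λ, μ.map (Sprinkling.act p Λ) = μ) {X : Type} [MeasurableSpace X]
    [MulAction (LorentzGroup d) X] [MeasurableConstSMul (LorentzGroup d) X]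
    (h : HasPartialEquivariantMap p μ X) : HasInvariantProbability d X := by
  obtain ⟨A, D, hA, hμA, hD, hequiv⟩ := h
  have happ : ∀ s : Set X, MeasurableSet s →
      ((μ.comap Subtype.val).map D) s = μ (Subtype.val '' (D ⁻¹' s)) := fun s hs => by
    rw [Measure.map_apply hD hs, comap_subtype_coe_apply hA]
  refine ⟨(μ A)⁻¹ • (μ.comap Subtype.val).map D, ⟨?_⟩, ⟨fun Λ s hs => ?_⟩⟩
  · rw [Measure.smul_apply, happ _ MeasurableSet.univ, smul_eq_mul, Set.preimage_univ,
      Set.image_univ, Subtype.range_coe, ENNReal.inv_mul_cancel hμA (measure_ne_top μ A)]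
  · rw [Measure.smul_apply, Measure.smul_apply, happ s hs,
      happ _ (measurable_const_smul Λ hs)]
    congr 1
    -- Invariance of `μ` is applied to the right side only; what remains is that `Λ • D ω ∈ s`
    -- exactly when the transformed sprinkling lies in `A` and `D` sends it into `s`.
    rw [← hμ Λ, Measure.map_apply (Sprinkling.measurable_act p Λ) (hA.subtype_image (hD hs)), hμ Λ]
    congr 1
    ext ω
    constructor
    · rintro ⟨ω, hω, rfl⟩
      obtain ⟨hmem, heq⟩ := hequiv Λ ω
      exact ⟨⟨_, hmem⟩, by rw [Set.mem_preimage, heq]; exact hω, rfl⟩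
    · rintro ⟨η, hη, hηω⟩
      -- Invariance of `A` under `Λ⁻¹` brings `ω` itself back into `A`.
      obtain ⟨hinv, -⟩ := hequiv Λ⁻¹ η
      have hωA : ω ∈ A := by
        rw [hηω, Sprinkling.act_inv_act] at hinv
        exact hinv
      obtain ⟨hmem, heq⟩ := hequiv Λ ⟨ω, hωA⟩
      refine ⟨⟨ω, hωA⟩, ?_, rfl⟩
      change Λ • D ⟨ω, hωA⟩ ∈ s
      rw [← heq, show (⟨_, hmem⟩ : A) = η from Subtype.ext hηω.symm]
      exact hη

/-- The sprinkling without points. -/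
def emptySprinkling (d : ℕ) : Sprinkling d := ⟨∅, fun K _ => by simp⟩

/-- The empty sprinkling is fixed by every Lorentz transformation, so its Dirac mass is invariant
and no Poisson process is needed. -/
theorem HasEquivariantMap.hasInvariantProbability {d : ℕ} {p : Mink d} {X : Type}
    [MeasurableSpace X] [MulAction (LorentzGroup d) X] [MeasurableConstSMul (LorentzGroup d) X]
    (h : HasEquivariantMap p X) : HasInvariantProbability d X := by
  obtain ⟨D, hD, hequiv⟩ := h
  refine HasPartialEquivariantMap.hasInvariantProbability (p := p)
    (μ := Measure.dirac (emptySprinkling d)) (fun Λ => ?_)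
    ⟨Set.univ, fun ω => D ω.val, MeasurableSet.univ, by simp, hD.comp measurable_subtype_coe,
      fun Λ ω => ⟨Set.mem_univ _, hequiv Λ ω⟩⟩
  rw [Measure.map_dirac' (Sprinkling.measurable_act p Λ)]
  congr 1
  exact Subtype.ext (Set.image_empty _)

theorem notDeterminedBySprinklings_of_not_hasInvariantProbability {d : ℕ} (p : Mink d) {X : Type}
    [MeasurableSpace X] [MulAction (LorentzGroup d) X] [MeasurableConstSMul (LorentzGroup d) X]
    (h : ¬ HasInvariantProbability d X) : NotDeterminedBySprinklings p X where
  no_invariant_probability := h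
  no_map hmap := h hmap.hasInvariantProbability
  no_partial_map ρ _ μ hμ hmap := by
    have := hμ.isProbabilityMeasure
    exact h (hmap.hasInvariantProbability (hμ.map_act_eq p))

/-! ### The spaces of directions -/

instance hyperboloid.measurableConstSMul (d : ℕ) (κ : DirKind) :
    MeasurableConstSMul (LorentzGroup d) (hyperboloid d κ) where
  measurable_const_smul Λ := by
    have h : Measurable (lorentzVec Λ) := by
      unfold lorentzVec
      exact (Continuous.matrix_mulVec continuous_const continuous_id).measurable
    exact (h.comp measurable_subtype_coe).subtype_mk

instance DirQuotient.measurableConstSMul (d : ℕ) {k : ℕ} (τ : Fin k → DirKind)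
    (G : Subgroup (Equiv.Perm (Fin k))) :
    MeasurableConstSMul (LorentzGroup d) (DirQuotient d τ G) where
  measurable_const_smul Λ :=
    measurable_from_quotient.mpr (measurable_quotient_mk''.comp (measurable_const_smul Λ))

theorem not_hasInvariantProbability_hyperboloid {d : ℕ} (hd : 0 < d) (κ : DirKind) :
    ¬ HasInvariantProbability d (hyperboloid d κ) := by
  refine not_hasInvariantProbability_of_doubling (ι := Fin d × Bool)
    (fun i x => |nullCoord i.1 i.2 x.val|) (fun i => doublingBoost i.1 i.2)
    (fun i => ((measurable_nullCoord i.1 i.2).comp measurable_subtype_coe).abs)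
    (fun i x => abs_nonneg _) (fun i x => ?_) fun x => ?_
  · change |nullCoord i.1 i.2 (lorentzVec (doublingBoost i.1 i.2) x.val)| = _
    rw [nullCoord_doublingBoost, abs_mul, abs_two]
  · obtain ⟨j, b, h⟩ := exists_nullCoord_ne_zero hd x.property
    exact ⟨(j, b), abs_ne_zero.mpr h⟩

/-- The sum of the absolute values of a null coordinate over the entries of a tuple. -/
def nullSum {d k : ℕ} {τ : Fin k → DirKind} (j : Fin d) (b : Bool) (v : DirTuple d τ) : ℝ :=
  ∑ i, |nullCoord j b (v i).val|

section nullSum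

variable {d k : ℕ} {τ : Fin k → DirKind} (j : Fin d) (b : Bool)

theorem nullSum_nonneg (v : DirTuple d τ) : 0 ≤ nullSum j b v :=
  Finset.sum_nonneg fun _ _ => abs_nonneg _

theorem measurable_nullSum : Measurable (nullSum (τ := τ) j b) :=
  Finset.measurable_sum _ fun i _ =>
    ((measurable_nullCoord j b).comp (measurable_subtype_coe.comp (measurable_pi_apply i))).abs

theorem nullSum_doublingBoost (v : DirTuple d τ) :
    nullSum j b (doublingBoost j b • v) = 2 * nullSum j b v := by
  rw [nullSum, nullSum, Finset.mul_sum]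
  refine Finset.sum_congr rfl fun i _ => ?_
  change |nullCoord j b (lorentzVec (doublingBoost j b) (v i).val)| = _
  rw [nullCoord_doublingBoost, abs_mul, abs_two]

theorem exists_nullSum_ne_zero (hd : 0 < d) (hk : 0 < k) (v : DirTuple d τ) :
    ∃ i : Fin d × Bool, nullSum i.1 i.2 v ≠ 0 := by
  -- One entry suffices, but there must be one: for `k = 0` the tuple space is a single point, which
  -- carries an invariant probability.
  obtain ⟨j, b, h⟩ := exists_nullCoord_ne_zero hd (v ⟨0, hk⟩).property
  refine ⟨(j, b), fun h0 => h ?_⟩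
  exact abs_eq_zero.mp ((Finset.sum_eq_zero_iff_of_nonneg fun _ _ => abs_nonneg _).mp h0 _
    (Finset.mem_univ _))

/-- A permutation only reorders the summands, so `nullSum` descends to the quotient. -/
theorem nullSum_eq_of_rel {G : Subgroup (Equiv.Perm (Fin k))} {v w : DirTuple d τ}
    (h : (permSetoid d τ G).r v w) : nullSum j b v = nullSum j b w := by
  obtain ⟨g, -, hg⟩ := h
  simp only [nullSum, hg]
  exact (Equiv.sum_comp g fun i => |nullCoord j b (v i).val|).symm

end nullSum

theorem not_hasInvariantProbability_dirTuple {d k : ℕ} (hd : 0 < d) (hk : 0 < k)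
    (τ : Fin k → DirKind) : ¬ HasInvariantProbability d (DirTuple d τ) :=
  not_hasInvariantProbability_of_doubling (ι := Fin d × Bool) (fun i => nullSum i.1 i.2)
    (fun i => doublingBoost i.1 i.2) (fun i => measurable_nullSum i.1 i.2)
    (fun i => nullSum_nonneg i.1 i.2) (fun i => nullSum_doublingBoost i.1 i.2)
    (exists_nullSum_ne_zero hd hk)

theorem not_hasInvariantProbability_dirQuotient {d k : ℕ} (hd : 0 < d) (hk : 0 < k)
    (τ : Fin k → DirKind) (G : Subgroup (Equiv.Perm (Fin k))) :
    ¬ HasInvariantProbability d (DirQuotient d τ G) :=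
  not_hasInvariantProbability_of_doubling (ι := Fin d × Bool)
    (fun i => Quotient.lift (nullSum i.1 i.2) fun _ _ h => nullSum_eq_of_rel i.1 i.2 h)
    (fun i => doublingBoost i.1 i.2)
    (fun i => measurable_from_quotient.mpr (measurable_nullSum i.1 i.2))
    (fun i q => Quotient.inductionOn q (nullSum_nonneg i.1 i.2))
    (fun i q => Quotient.inductionOn q (nullSum_doublingBoost i.1 i.2))
    (fun q => Quotient.inductionOn q (exists_nullSum_ne_zero hd hk))

theorem mainTheorem3 (d : ℕ) (hd : 1 < d + 1) (p : Mink d) :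
    NotDeterminedBySprinklings p (hyperboloid d DirKind.spacelike) ∧
    ∀ (k : ℕ) (_ : 1 ≤ k) (τ : Fin k → DirKind),
      NotDeterminedBySprinklings p (DirTuple d τ) ∧
      ∀ G : Subgroup (Equiv.Perm (Fin k)), (∀ g ∈ G, ∀ i, τ (g i) = τ i) →
        NotDeterminedBySprinklings p (DirQuotient d τ G) := by
  have hd' : 0 < d := Nat.lt_of_add_lt_add_right (n := 1) (by simpa using hd)
  exact ⟨notDeterminedBySprinklings_of_not_hasInvariantProbability p
      (not_hasInvariantProbability_hyperboloid hd' _), fun k hk τ =>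
    ⟨notDeterminedBySprinklings_of_not_hasInvariantProbability p
      (not_hasInvariantProbability_dirTuple hd' hk τ), fun G _ =>
    notDeterminedBySprinklings_of_not_hasInvariantProbability p
      (not_hasInvariantProbability_dirQuotient hd' hk τ G)⟩⟩
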